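/- **Setting.** Let $n\ge 2$, let $x_1,\dots,x_n$ be distinct points of a set $\mathcal X\subseteq\mathbb R^d$, let $\Theta_\rho\subseteq\mathbb R^q$, and let $r(x,x',\theta_\rho)$ be a parametric correlation function: for every $\theta_\rho\in\Theta_\rho$ one has $r(x,x,\theta_\rho)=1$ on $\mathcal X$, and all matrices $(r(z_i,z_j,\theta_\rho))_{ij}$ with $z_1,\dots,z_m\in\mathcal X$ are symmetric positive semidefinite. Put $\mathbf r(\theta_\rho)=(r(x_i,x_j,\theta_\rho))_{i,j}\in\mathbb R^{n^2}$. Let $\theta^*=(\theta^*_\rho,\theta^*_v)$ with $\theta_\rho^*\in\operatorname{int}\Theta_\rho$ and $\theta_v^*>0$ be the true parameters (there is no nugget), let $C^*=(\theta_v^*\,r(x_i,x_j,\theta_\rho^*))_{ij}$ be positive definite, $P^*=(C^*)^{-1}$, and let $0<a^*\le b^*<\infty$ satisfy $a^*I\preceq P^*\preceq b^*I$. All vector norms are Euclidean. **The two-stage SPS estimate.** Let $y^{(1)},\dots,y^{(N)}$ be independent $\mathcal N(0,C^*)$ vectors (independent realizations, observed at $x_1,\dots,x_n$, of the zero-mean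 Gaussian random field with covariance function $\theta_v^*r(\cdot,\cdot,\theta_\rho^*)$), let $S=\frac1N\sum_s y^{(s)}y^{(s)\top}$, and let $G_{ij}=\|x_i-x_j\|$ for $i\ne j$ and $G_{ii}=\min_{j\neq i}\|x_i-x_j\|$. Stage I: for $\alpha>0$, $$\hat P\in\arg\min\Big\{\operatorname{Tr}(SP)-\log\det P+\alpha\sum_{i,j}G_{ij}|P_{ij}|\ :\ a^*I\preceq P\preceq b^*I\Big\}.$$ Stage II: let $\hat{\mathbf c}\in\mathbb R^{n^2}$ be the vector of the entries of $\hat P^{-1}$, and for $\mathbf c\in\mathbb R^{n^2}$ put $v(\theta_\rho;\mathbf c)=\max\{0,\mathbf r(\theta_\rho)^\top\mathbf c/\|\mathbf r(\theta_\rho)\|^2\}$ and $f(\theta_\rho;\mathbf c)=\frac12\|v(\theta_\rho;\mathbf c)\,\mathbf r(\theta_\rho)-\mathbf c\|^2$. Then $\hat\theta=(\hat\theta_\rho,\hat\theta_v)$ with $\hat\theta_\rho\in\arg\min_{\Theta_\rho}f(\cdot;\hat{\mathbf c})$ and $\hat\theta_v=v(\hat\theta_\rho;\hat{\mathbf c})$.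 **Theorem.** Suppose that $\mathbf r$ is twice continuously differentiable on $\operatorname{int}\Theta_\rho$, that $\mathbf r(\theta^*_\rho),\partial_1\mathbf r(\theta^*_\rho),\dots,\partial_q\mathbf r(\theta^*_\rho)$ are linearly independent, and that $\theta_\rho^*$ is identifiable in $\Theta_\rho$: for every $\delta>0$ there is $\eta>0$ such that $\theta_\rho\in\Theta_\rho$ and $\|\mathbf r(\theta_\rho)-\mathbf r(\theta_\rho^*)\|\le\eta$ imply $\|\theta_\rho-\theta_\rho^*\|\le\delta$. Then there are constants $K,m,\delta>0$, which depend on neither $M$ nor $\varepsilon$, such that the following holds for all $M>0$ and $\varepsilon>0$. Let $N_0=\lceil 2(M\ln n+\ln 4)\rceil$. There is an integer $N\ge N_0$ with $N\le K N_0\max\{1,\varepsilon^{-2}\}$ (so $N=O(N_0/\varepsilon^2)$ as $\varepsilon\to0$) such that, for $\alpha=40\,\theta_v^*\sqrt{N_0/N}$, with probability at least $1-n^{-M}$ a two-stage SPS estimate exists, every such estimate satisfies $\|\hat\theta-\theta^*\|\le\varepsilon$, and the Stage-II objective $f(\cdot;\hat{\mathbf c})$ is strongly convex around $\hat\theta_\rho$,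 namely with modulus $m$ on the ball of radius $\delta$ about $\hat\theta_\rho$. -/

import Mathlib

open MeasureTheory ProbabilityTheory

noncomputable section

namespace SPS

/-- Euclidean space `ℝᵏ`. -/
abbrev E (k : ℕ) := EuclideanSpace ℝ (Fin k)

/-- The long vectors in `ℝ^{n²}`, indexed by pairs, with the Euclidean norm. -/
abbrev LongVec (n : ℕ) := EuclideanSpace ℝ (Fin n × Fin n)

/-- Parameter vectors `θ = (θ_ρ, θ_v) ∈ ℝ^{q+1}` (no nugget), with the Euclidean norm. -/
abbrev Param (q : ℕ) := WithLp 2 (E q × ℝ)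

/-- `k` is a correlation function on `X`: it has unit diagonal, and all the matrices that it
forms on finitely many points of `X` are symmetric and positive semidefinite. -/
def IsCorrelationFunction {d : ℕ} (X : Set (E d)) (k : E d → E d → ℝ) : Prop :=
  (∀ z ∈ X, k z z = 1) ∧
    ∀ (m : ℕ) (z : Fin m → E d), (∀ i, z i ∈ X) →
      (Matrix.of fun i j => k (z i) (z j)).PosSemidef

section Model

variable {d q n : ℕ} (k : E d → E d → E q → ℝ) (x : Fin n → E d)

/-- The covariance matrix `C(θ) = (θ_v k(x_i, x_j, θ_ρ))_{ij}` at the locations `x`. -/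
def covMatrix (θ : Param q) : Matrix (Fin n) (Fin n) ℝ :=
  Matrix.of fun i j => θ.snd * k (x i) (x j) θ.fst

/-- The correlation vector `r(θ_ρ) = (k(x_i, x_j, θ_ρ))_{ij} ∈ ℝ^{n²}`. -/
def corrVec (θρ : E q) : LongVec n :=
  WithLp.toLp 2 fun p => k (x p.1) (x p.2) θρ

/-- A matrix as a long vector. -/
def longVec (C : Matrix (Fin n) (Fin n) ℝ) : LongVec n :=
  WithLp.toLp 2 fun p => C p.1 p.2

/-- The distance weights: `G_ij = ‖x_i - x_j‖` for `i ≠ j`, and `G_ii` is the distance from `x_i`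
to the nearest other location. -/
def weight : Matrix (Fin n) (Fin n) ℝ :=
  Matrix.of fun i j => if i = j then ⨅ l : {l : Fin n // l ≠ i}, ‖x i - x l‖ else ‖x i - x j‖

/-- The sample covariance matrix `S = (1/N) ∑_r y⁽ʳ⁾ (y⁽ʳ⁾)ᵀ` of (centered) data. -/
def sampleCov {N : ℕ} (y : Fin N → E n) : Matrix (Fin n) (Fin n) ℝ :=
  Matrix.of fun i j => (1 / (N : ℝ)) * ∑ s, y s i * y s j

/-- The objective `⟨S, P⟩ - log det P + α ⟨G, |P|⟩` of the first stage. -/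
def stageOneObj (S G : Matrix (Fin n) (Fin n) ℝ) (α : ℝ) (P : Matrix (Fin n) (Fin n) ℝ) : ℝ :=
  (S.transpose * P).trace - Real.log P.det + α * ∑ i, ∑ j, G i j * |P i j|

/-- The spectral box `a I ⪯ P ⪯ b I` in the symmetric matrices. -/
def spectralBox (n : ℕ) (a b : ℝ) : Set (Matrix (Fin n) (Fin n) ℝ) :=
  {P | (P - a • (1 : Matrix (Fin n) (Fin n) ℝ)).PosSemidef ∧
    (b • (1 : Matrix (Fin n) (Fin n) ℝ) - P).PosSemidef}

/-- `P` solves the first stage: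
`P ∈ argmin {⟨S, P⟩ - log det P + α ⟨G, |P|⟩ : a I ⪯ P ⪯ b I}`. -/
def IsStageOne (a b α : ℝ) (S P : Matrix (Fin n) (Fin n) ℝ) : Prop :=
  P ∈ spectralBox n a b ∧ IsMinOn (stageOneObj S (weight x) α) (spectralBox n a b) P

/-- The variance parameter `max {0, r(θ_ρ)ᵀ c / ‖r(θ_ρ)‖²}` fitted to `c` for given `θ_ρ`. -/
def fitVar (c : LongVec n) (θρ : E q) : ℝ :=
  max 0 (inner ℝ (corrVec k x θρ) c / ‖corrVec k x θρ‖ ^ 2)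

/-- The objective `f(θ_ρ; c)` of the second stage. -/
def stageTwoObj (c : LongVec n) (θρ : E q) : ℝ :=
  1 / 2 * ‖fitVar k x c θρ • corrVec k x θρ - c‖ ^ 2

/-- `θ` solves the second stage for `c`: `θ_ρ ∈ argmin_{Θ_ρ} f(·; c)`, and `θ_v` is the fitted
variance parameter. -/
def IsStageTwo (Θρ : Set (E q)) (c : LongVec n) (θ : Param q) : Prop :=
  θ.fst ∈ Θρ ∧ IsMinOn (stageTwoObj k x c) Θρ θ.fst ∧ θ.snd = fitVar k x c θ.fst

/-- The spatial parameter `θ_ρ` is identifiable within `Θ_ρ` from the correlation vector: parameters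
in `Θ_ρ` whose correlation vectors approach `r(θ_ρ)` have to approach `θ_ρ`. -/
def IdentifiableAt (Θρ : Set (E q)) (θρ : E q) : Prop :=
  ∀ δ > 0, ∃ η > 0, ∀ t ∈ Θρ, ‖corrVec k x t - corrVec k x θρ‖ ≤ η → ‖t - θρ‖ ≤ δ

end Model

/-- `N₀ = ⌈2 (M ln n + ln 4)⌉`. -/
def sampleBase (n : ℕ) (M : ℝ) : ℕ :=
  ⌈2 * (M * Real.log n + Real.log 4)⌉₊

/-- `y⁽¹⁾, …, y⁽ᴺ⁾` are independent realizations of the zero-mean Gaussian random field with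
covariance function `θ_v k(·, ·, θ_ρ)`, observed at the locations `x`. -/
def IsGRFSample {d q n N : ℕ} (k : E d → E d → E q → ℝ) (x : Fin n → E d) (θ : Param q)
    {Ω : Type*} [MeasurableSpace Ω] (μ : Measure Ω) (y : Fin N → Ω → E n) : Prop :=
  iIndepFun y μ ∧ ∀ s, HasLaw (y s) (multivariateGaussian 0 (covMatrix k x θ)) μ

end SPS

end

namespace SPS

section MatrixNorm

variable {n : ℕ}

theorem longVec_sub (A B : Matrix (Fin n) (Fin n) ℝ) :
    longVec (A - B) = longVec A - longVec B := by
  ext p; simp [longVec]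

theorem norm_longVec_sq (A : Matrix (Fin n) (Fin n) ℝ) :
    ‖longVec A‖ ^ 2 = ∑ i, ∑ j, A i j ^ 2 := by
  rw [EuclideanSpace.real_norm_sq_eq, Fintype.sum_prod_type]
  simp [longVec]

theorem trace_transpose_mul_eq_inner (A B : Matrix (Fin n) (Fin n) ℝ) :
    (A.transpose * B).trace = inner ℝ (longVec A) (longVec B) := by
  simp only [Matrix.trace, Matrix.diag, Matrix.mul_apply, Matrix.transpose_apply,
    PiLp.inner_apply, Fintype.sum_prod_type, longVec]
  rw [Finset.sum_comm]
  simp [mul_comm]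

theorem abs_apply_le_norm_longVec (A : Matrix (Fin n) (Fin n) ℝ) (i j : Fin n) :
    |A i j| ≤ ‖longVec A‖ := by
  simpa [longVec] using PiLp.norm_apply_le (longVec A) (i, j)

section

attribute [local instance] Matrix.frobeniusNormedAddCommGroup

theorem norm_longVec_eq_frobenius (A : Matrix (Fin n) (Fin n) ℝ) : ‖longVec A‖ = ‖A‖ := by
  rw [Matrix.frobenius_norm_def, EuclideanSpace.norm_eq, Real.sqrt_eq_rpow,
    Fintype.sum_prod_type]
  simp [longVec]

theorem norm_longVec_mul_le (A B : Matrix (Fin n) (Fin n) ℝ) :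
    ‖longVec (A * B)‖ ≤ ‖longVec A‖ * ‖longVec B‖ := by
  simp only [norm_longVec_eq_frobenius]
  exact Matrix.frobenius_norm_mul A B

end

/-- The sum of the squared entries of `A - 1` through the eigenvalues of `A`. -/
theorem norm_longVec_sub_one_sq {A : Matrix (Fin n) (Fin n) ℝ} (hA : A.IsHermitian) :
    ‖longVec (A - 1)‖ ^ 2 = ∑ i, (hA.eigenvalues i - 1) ^ 2 := by
  have hT : A.transpose = A := by simpa [Matrix.IsHermitian] using hA
  have h2 : (A * A).trace = ∑ i, hA.eigenvalues i ^ 2 := by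
    conv_lhs => rw [hA.spectral_theorem, ← map_mul, Unitary.conjStarAlgAut_apply,
      Matrix.trace_mul_cycle, Unitary.coe_star_mul_self, one_mul, Matrix.diagonal_mul_diagonal]
    simp [Matrix.trace_diagonal, sq]
  have h1 : A.trace = ∑ i, hA.eigenvalues i := by simpa using hA.trace_eq_sum_eigenvalues
  rw [← real_inner_self_eq_norm_sq, ← trace_transpose_mul_eq_inner]
  have : (A - 1).transpose * (A - 1) = A * A - (2 : ℝ) • A + 1 := by
    rw [Matrix.transpose_sub, hT, Matrix.transpose_one, two_smul]
    noncomm_ring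
  rw [this, Matrix.trace_add, Matrix.trace_sub, Matrix.trace_smul, h1, h2]
  simp only [sub_sq, Finset.sum_add_distrib, Finset.sum_sub_distrib, Matrix.trace_one]
  simp [Finset.mul_sum]

end MatrixNorm

/-- A quantitative form of `log t ≤ t - 1`. -/
theorem sq_sub_one_le_sub_one_sub_log {B t : ℝ} (ht : 0 < t) (htB : t ≤ B) :
    1 / (2 * (B + 1)) * (t - 1) ^ 2 ≤ t - 1 - Real.log t := by
  have hs : 0 < √t := Real.sqrt_pos.2 ht
  have hsq : √t ^ 2 = t := Real.sq_sqrt ht.le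
  have hlog : Real.log t ≤ 2 * (√t - 1) := by
    have := Real.log_le_sub_one_of_pos hs
    rw [Real.log_sqrt ht.le] at this
    linarith
  have h1 : (√t - 1) ^ 2 ≤ t - 1 - Real.log t := by nlinarith
  refine le_trans ?_ h1
  rw [one_div, inv_mul_le_iff₀ (by linarith)]
  have h2 : (t - 1) ^ 2 = (√t + 1) ^ 2 * (√t - 1) ^ 2 := by
    linear_combination (-(√t ^ 2 + t - 2)) * hsq
  rw [h2]
  gcongr
  nlinarith [sq_nonneg (√t - 1)]

section LogDet

variable {n : ℕ}

/-- Strong convexity of `-log det` at `C⁻¹`, uniformly over a set where `tr (C Q)` is bounded. -/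
theorem exists_logDet_strong_convexity {C : Matrix (Fin n) (Fin n) ℝ} (hC : C.PosDef) (B : ℝ) :
    ∃ κ > 0, ∀ Q : Matrix (Fin n) (Fin n) ℝ, Q.PosDef → (C * Q).trace ≤ B →
      κ * ‖longVec (Q - C⁻¹)‖ ^ 2 ≤ (C * Q).trace - n - Real.log Q.det - Real.log C.det := by
  obtain ⟨F, hF⟩ : ∃ F : Matrix (Fin n) (Fin n) ℝ, C = F.conjTranspose * F := by
    open scoped MatrixOrder in
    exact CStarAlgebra.nonneg_iff_eq_star_mul_self.1 hC.posSemidef.nonneg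
  rw [Matrix.conjTranspose_eq_transpose_of_trivial] at hF
  have hdetC : C.det = F.det * F.det := by rw [hF, Matrix.det_mul, Matrix.det_transpose]
  have hFdet : IsUnit F.det := by
    rw [isUnit_iff_ne_zero]
    intro h
    have := hC.det_pos
    rw [hdetC, h] at this
    simp at this
  have hFTdet : IsUnit F.transpose.det := by rwa [Matrix.det_transpose]
  set B' := max B 0
  set W := ‖longVec F⁻¹‖ * ‖longVec F.transpose⁻¹‖ with hW
  have hW0 : 0 ≤ W := by positivity
  refine ⟨1 / (2 * (B' + 1)) * (1 / (W ^ 2 + 1)), by positivity, fun Q hQ hB => ?_⟩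
  have hH : (F * Q * F.transpose).PosDef := by
    have := hQ.mul_mul_conjTranspose_same (B := F)
      (Matrix.vecMul_injective_iff_isUnit.2 ((Matrix.isUnit_iff_isUnit_det F).2 hFdet))
    simpa [Matrix.conjTranspose_eq_transpose_of_trivial] using this
  set H := F * Q * F.transpose with hHdef
  set lam := hH.1.eigenvalues
  have hpos : ∀ i, 0 < lam i := fun i => hH.eigenvalues_pos i
  have htr : ∑ i, lam i = (C * Q).trace := by
    have h1 : H.trace = ∑ i, lam i := by simpa using hH.1.trace_eq_sum_eigenvalues
    rw [← h1, hHdef, Matrix.trace_mul_comm, ← mul_assoc, ← hF]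
  have hdet : ∑ i, Real.log (lam i) = Real.log Q.det + Real.log C.det := by
    have h1 : H.det = ∏ i, lam i := by simpa using hH.1.det_eq_prod_eigenvalues
    rw [← Real.log_prod fun i _ => (hpos i).ne', ← h1,
      ← Real.log_mul hQ.det_pos.ne' hC.det_pos.ne', hHdef, hdetC]
    simp only [Matrix.det_mul, Matrix.det_transpose]
    congr 1
    ring
  have hle : ∀ i, lam i ≤ B' := fun i =>
    ((Finset.single_le_sum (fun j _ => (hpos j).le) (Finset.mem_univ i)).trans
      (htr.trans_le hB)).trans (le_max_left _ _)
  have hsum : 1 / (2 * (B' + 1)) * ‖longVec (H - 1)‖ ^ 2 ≤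
      (C * Q).trace - n - Real.log Q.det - Real.log C.det := by
    rw [norm_longVec_sub_one_sq hH.1, Finset.mul_sum]
    calc _ ≤ ∑ i, (lam i - 1 - Real.log (lam i)) :=
          Finset.sum_le_sum fun i _ => sq_sub_one_le_sub_one_sub_log (hpos i) (hle i)
      _ = _ := by
          rw [Finset.sum_sub_distrib, Finset.sum_sub_distrib, htr, hdet]
          simp
          ring
  have hQC : Q - C⁻¹ = F⁻¹ * (H - 1) * F.transpose⁻¹ := by
    rw [mul_sub, sub_mul, hHdef, hF, Matrix.mul_inv_rev, mul_one]
    congr 1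
    rw [← mul_assoc, ← mul_assoc, Matrix.nonsing_inv_mul _ hFdet, one_mul, mul_assoc,
      Matrix.mul_nonsing_inv _ hFTdet, mul_one]
  have hn : ‖longVec (Q - C⁻¹)‖ ≤ W * ‖longVec (H - 1)‖ := by
    rw [hQC]
    calc _ ≤ ‖longVec (F⁻¹ * (H - 1))‖ * ‖longVec F.transpose⁻¹‖ := norm_longVec_mul_le _ _
      _ ≤ ‖longVec F⁻¹‖ * ‖longVec (H - 1)‖ * ‖longVec F.transpose⁻¹‖ := by
          gcongr; exact norm_longVec_mul_le _ _
      _ = _ := by rw [hW]; ring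
  refine le_trans ?_ hsum
  rw [mul_assoc]
  gcongr
  rw [one_div, inv_mul_le_iff₀ (by positivity)]
  calc _ ≤ (W * ‖longVec (H - 1)‖) ^ 2 := by gcongr
    _ ≤ _ := by nlinarith [sq_nonneg ‖longVec (H - 1)‖]

end LogDet

section SpectralBox

variable {n : ℕ} {a b : ℝ}

theorem spectralBox_posDef (ha : 0 < a) {P : Matrix (Fin n) (Fin n) ℝ}
    (hP : P ∈ spectralBox n a b) : P.PosDef := by
  have h : (a • (1 : Matrix (Fin n) (Fin n) ℝ)).PosDef := Matrix.PosDef.one.smul ha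
  simpa using h.add_posSemidef hP.1

theorem isClosed_posSemidef :
    IsClosed {P : Matrix (Fin n) (Fin n) ℝ | P.PosSemidef} := by
  simp only [Matrix.posSemidef_iff_dotProduct_mulVec, Set.ofPred_and, Matrix.IsHermitian]
  refine (isClosed_eq (by fun_prop) (by fun_prop)).inter ?_
  simp only [Set.ofPred_forall]
  exact isClosed_iInter fun v => isClosed_le continuous_const (by fun_prop)

theorem isClosed_spectralBox : IsClosed (spectralBox n a b) := by
  refine IsClosed.inter (s₂ := {P | (b • (1 : Matrix (Fin n) (Fin n) ℝ) - P).PosSemidef}) ?_ ?_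
  · exact isClosed_posSemidef.preimage (f := fun P => P - a • (1 : Matrix (Fin n) (Fin n) ℝ))
      (by fun_prop)
  · exact isClosed_posSemidef.preimage (f := fun P => b • (1 : Matrix (Fin n) (Fin n) ℝ) - P)
      (by fun_prop)

/-- An off-diagonal entry of a positive semidefinite matrix is at most the mean of the two
diagonal entries. -/
theorem two_mul_abs_apply_le_of_posSemidef {P : Matrix (Fin n) (Fin n) ℝ} (hP : P.PosSemidef)
    (i j : Fin n) : 2 * |P i j| ≤ P i i + P j j := by
  have hs : P j i = P i j := by simpa using hP.1.apply i j
  have h1 := hP.dotProduct_mulVec_nonneg (Pi.single i 1 + Pi.single j 1)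
  have h2 := hP.dotProduct_mulVec_nonneg (Pi.single i 1 - Pi.single j 1)
  simp [Matrix.mulVec_add, Matrix.mulVec_sub, add_dotProduct, sub_dotProduct] at h1 h2
  have : |P i j| ≤ (P i i + P j j) / 2 := by
    rw [abs_le]
    constructor <;> linarith
  linarith

theorem abs_apply_le_of_mem_spectralBox (ha : 0 < a) {P : Matrix (Fin n) (Fin n) ℝ}
    (hP : P ∈ spectralBox n a b) (i j : Fin n) : |P i j| ≤ b := by
  have hd : ∀ l, P l l ≤ b := fun l => by
    have := hP.2.diag_nonneg (i := l)
    simpa using this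
  have := two_mul_abs_apply_le_of_posSemidef (spectralBox_posDef ha hP).posSemidef i j
  linarith [hd i, hd j]

theorem isCompact_spectralBox (ha : 0 < a) : IsCompact (spectralBox n a b) := by
  have : IsCompact (Set.univ.pi fun _ : Fin n => Set.univ.pi fun _ : Fin n => Set.Icc (-b) b) :=
    isCompact_univ_pi fun _ => isCompact_univ_pi fun _ => isCompact_Icc
  refine this.of_isClosed_subset isClosed_spectralBox fun P hP i _ j _ => ?_
  exact abs_le.1 (abs_apply_le_of_mem_spectralBox ha hP i j)

theorem continuous_longVec :
    Continuous (longVec : Matrix (Fin n) (Fin n) ℝ → LongVec n) := by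
  unfold longVec
  fun_prop

theorem continuousOn_inv_spectralBox (ha : 0 < a) :
    ContinuousOn (fun P : Matrix (Fin n) (Fin n) ℝ => P⁻¹) (spectralBox n a b) := by
  simp only [Matrix.inv_def, Ring.inverse_eq_inv']
  exact (ContinuousOn.inv₀ (by fun_prop) fun P hP => (spectralBox_posDef ha hP).det_pos.ne').smul
    (by fun_prop)

theorem exists_isStageOne {d : ℕ} (x : Fin n → E d) (ha : 0 < a)
    (hne : (spectralBox n a b).Nonempty) (α : ℝ) (S : Matrix (Fin n) (Fin n) ℝ) :
    ∃ P, IsStageOne x a b α S P := by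
  refine (isCompact_spectralBox ha).exists_isMinOn hne ?_
  unfold stageOneObj
  refine ContinuousOn.add (ContinuousOn.sub (by fun_prop) (ContinuousOn.log (by fun_prop) ?_))
    (by fun_prop)
  exact fun P hP => (spectralBox_posDef ha hP).det_pos.ne'

end SpectralBox

section StageOne

variable {d n : ℕ} {a b : ℝ}

/-- Stage I estimates the precision matrix at the rate of the sample covariance matrix. -/
theorem exists_stageOne_precision_rate (x : Fin n → E d) (ha : 0 < a)
    {C : Matrix (Fin n) (Fin n) ℝ} (hC : C.PosDef) (hP : C⁻¹ ∈ spectralBox n a b) :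
    ∃ L > 0, ∀ (S : Matrix (Fin n) (Fin n) ℝ) (α : ℝ), 0 ≤ α → ∀ P, IsStageOne x a b α S P →
      ‖longVec (P - C⁻¹)‖ ≤ L * (‖longVec (S - C)‖ + α) := by
  have hCT : C.transpose = C := by
    simpa [Matrix.conjTranspose_eq_transpose_of_trivial] using hC.1.eq
  have hCdet : IsUnit C.det := isUnit_iff_ne_zero.2 hC.det_pos.ne'
  obtain ⟨B, hB⟩ := (isCompact_spectralBox (n := n) (b := b) ha).exists_bound_of_continuousOn
    (f := fun P => (C * P).trace) (by fun_prop)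
  obtain ⟨κ, hκ, hconv⟩ := exists_logDet_strong_convexity hC B
  set g := ∑ i, ∑ j, |weight x i j| with hg
  have hg0 : 0 ≤ g := Finset.sum_nonneg fun _ _ => Finset.sum_nonneg fun _ _ => abs_nonneg _
  refine ⟨(1 + g) / κ, by positivity, fun S α hα P hS => ?_⟩
  have hPpos := spectralBox_posDef ha hS.1
  have h1 := hconv P hPpos ((le_abs_self _).trans (hB P hS.1))
  have h2 : stageOneObj S (weight x) α P ≤ stageOneObj S (weight x) α C⁻¹ := hS.2 hP
  set D := ‖longVec (P - C⁻¹)‖ with hD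
  have htr : (S.transpose * C⁻¹).trace - (S.transpose * P).trace + ((C * P).trace - n) =
      - inner ℝ (longVec (S - C)) (longVec (P - C⁻¹)) := by
    rw [← trace_transpose_mul_eq_inner, Matrix.transpose_sub, hCT, sub_mul, mul_sub, mul_sub,
      Matrix.mul_nonsing_inv _ hCdet]
    simp only [Matrix.trace_sub, Matrix.trace_one, Fintype.card_fin]
    ring
  have hin : |inner ℝ (longVec (S - C)) (longVec (P - C⁻¹))| ≤ ‖longVec (S - C)‖ * D :=
    abs_real_inner_le_norm _ _
  have hG : ∑ i, ∑ j, weight x i j * |C⁻¹ i j| - ∑ i, ∑ j, weight x i j * |P i j| ≤ g * D := by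
    rw [← Finset.sum_sub_distrib, hg, Finset.sum_mul]
    refine Finset.sum_le_sum fun i _ => ?_
    rw [← Finset.sum_sub_distrib, Finset.sum_mul]
    refine Finset.sum_le_sum fun j _ => ?_
    rw [← mul_sub]
    calc _ ≤ |weight x i j| * |(|C⁻¹ i j| - |P i j|)| := by
          rw [← abs_mul]; exact le_abs_self _
      _ ≤ _ := by
          gcongr
          refine (abs_abs_sub_abs_le_abs_sub _ _).trans ?_
          rw [abs_sub_comm]
          exact abs_apply_le_norm_longVec (P - C⁻¹) i j
  have hdet : Real.log C⁻¹.det = - Real.log C.det := by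
    rw [Matrix.det_nonsing_inv, Ring.inverse_eq_inv', Real.log_inv]
  unfold stageOneObj at h2
  rw [hdet] at h2
  have hαG := mul_le_mul_of_nonneg_left hG hα
  have hkey : κ * D ^ 2 ≤ (‖longVec (S - C)‖ + α * g) * D := by
    have := neg_abs_le (inner ℝ (longVec (S - C)) (longVec (P - C⁻¹)))
    linarith
  have hD0 : 0 ≤ D := norm_nonneg _
  have hκD : κ * D ≤ ‖longVec (S - C)‖ + α * g := by
    rcases hD0.eq_or_lt with h | h
    · rw [← h, mul_zero]; positivity
    · exact le_of_mul_le_mul_right (by linarith [sq D]) h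
  rw [div_mul_eq_mul_div, le_div_iff₀ hκ]
  nlinarith [norm_nonneg (longVec (S - C)), mul_nonneg hg0 (norm_nonneg (longVec (S - C)))]

theorem exists_stageOne_covariance_rate (x : Fin n → E d) (ha : 0 < a)
    {C : Matrix (Fin n) (Fin n) ℝ} (hC : C.PosDef) (hP : C⁻¹ ∈ spectralBox n a b) :
    ∃ L > 0, ∀ (S : Matrix (Fin n) (Fin n) ℝ) (α : ℝ), 0 ≤ α → ∀ P, IsStageOne x a b α S P →
      ‖longVec P⁻¹ - longVec C‖ ≤ L * (‖longVec (S - C)‖ + α) := by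
  have hCdet : IsUnit C.det := isUnit_iff_ne_zero.2 hC.det_pos.ne'
  obtain ⟨L, hL, hrate⟩ := exists_stageOne_precision_rate x ha hC hP
  obtain ⟨B, hB⟩ := (isCompact_spectralBox (n := n) (b := b) ha).exists_bound_of_continuousOn
    (f := fun P => longVec P⁻¹)
    (continuous_longVec.comp_continuousOn (continuousOn_inv_spectralBox ha))
  set W := |B| * ‖longVec C‖ with hW
  refine ⟨(W + 1) * L, by positivity, fun S α hα P hS => ?_⟩
  have hPdet : IsUnit P.det := isUnit_iff_ne_zero.2 (spectralBox_posDef ha hS.1).det_pos.ne'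
  have heq : C - P⁻¹ = P⁻¹ * (P - C⁻¹) * C := by
    rw [mul_sub, sub_mul, Matrix.nonsing_inv_mul _ hPdet, one_mul, mul_assoc,
      Matrix.nonsing_inv_mul _ hCdet, mul_one]
  rw [norm_sub_rev, ← longVec_sub, heq]
  calc _ ≤ ‖longVec (P⁻¹ * (P - C⁻¹))‖ * ‖longVec C‖ := norm_longVec_mul_le _ _
    _ ≤ ‖longVec P⁻¹‖ * ‖longVec (P - C⁻¹)‖ * ‖longVec C‖ := by
        gcongr; exact norm_longVec_mul_le _ _
    _ ≤ |B| * ‖longVec (P - C⁻¹)‖ * ‖longVec C‖ := by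
        gcongr; exact (hB P hS.1).trans (le_abs_self _)
    _ = W * ‖longVec (P - C⁻¹)‖ := by rw [hW]; ring
    _ ≤ (W + 1) * (L * (‖longVec (S - C)‖ + α)) := by
        gcongr
        · linarith
        · exact hrate S α hα P hS
    _ = _ := by ring

end StageOne

section StrongConvexity

variable {V : Type*} [NormedAddCommGroup V] [NormedSpace ℝ V]

theorem strongConvexOn_of_forall_exists_linear_minorant {s : Set V} (hs : Convex ℝ s) {m : ℝ}
    {f : V → ℝ}
    (h : ∀ z ∈ s, ∃ l : V →ₗ[ℝ] ℝ, ∀ x ∈ s, f z + l (x - z) + m / 2 * ‖x - z‖ ^ 2 ≤ f x) :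
    StrongConvexOn s m f := by
  refine ⟨hs, fun x hx y hy a b ha hb hab => ?_⟩
  obtain ⟨l, hl⟩ := h _ (hs hx hy ha hb hab)
  have hxz : x - (a • x + b • y) = b • (x - y) := by
    rw [← eq_sub_iff_add_eq'] at hab
    rw [hab]; module
  have hyz : y - (a • x + b • y) = (-a) • (x - y) := by
    rw [← eq_sub_iff_add_eq'] at hab
    rw [hab]; module
  have h1 := mul_le_mul_of_nonneg_left (hl x hx) ha
  have h2 := mul_le_mul_of_nonneg_left (hl y hy) hb
  rw [hxz, map_smul, norm_smul, Real.norm_eq_abs, mul_pow, sq_abs] at h1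
  rw [hyz, map_smul, norm_smul, Real.norm_eq_abs, mul_pow, sq_abs] at h2
  simp only [smul_eq_mul] at *
  have hb' : b = 1 - a := by linarith
  subst hb'
  nlinarith

variable {W F : Type*} [NormedAddCommGroup W] [NormedSpace ℝ W]
  [NormedAddCommGroup F] [InnerProductSpace ℝ F]

/-- A nonlinear least squares objective is strongly convex near a zero of the residual at which
the residual has an injective derivative, uniformly in a parameter. -/
theorem exists_strongConvexOn_half_norm_sq {φ : V × W → F} {p : V × W}
    (hφ : ContDiffAt ℝ 2 φ p) (h0 : φ p = 0) {κ : ℝ} (hκ : 0 < κ)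
    (hinj : ∀ h, κ * ‖h‖ ≤ ‖fderiv ℝ φ p (h, 0)‖) :
    ∃ m > 0, ∃ r > 0, ∀ c ∈ Metric.ball p.2 r,
      StrongConvexOn (Metric.ball p.1 r) m fun t => 1 / 2 * ‖φ (t, c)‖ ^ 2 := by
  have hD : ContDiffAt ℝ 1 (fderiv ℝ φ) p := hφ.fderiv_right (by norm_num)
  obtain ⟨K, U, hU, hLip⟩ := hD.exists_lipschitzOnWith
  set B := ‖fderiv ℝ φ p‖ + κ / 2 with hB
  have hB0 : 0 < B := by positivity
  set η := κ ^ 2 / (32 * (K + 1)) with hη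
  have hη0 : 0 < η := by positivity
  have hev : ∀ᶠ z in nhds p, z ∈ U ∧ DifferentiableAt ℝ φ z ∧
      dist (fderiv ℝ φ z) (fderiv ℝ φ p) < κ / 2 ∧ ‖φ z‖ < η := by
    refine Filter.Eventually.and hU (Filter.Eventually.and ?_ (Filter.Eventually.and ?_ ?_))
    · exact (hφ.eventually (by simp)).mono fun z hz => hz.differentiableAt (by simp)
    · exact hD.continuousAt.eventually (Metric.ball_mem_nhds _ (by positivity))
    · exact hφ.continuousAt.norm.eventually_lt continuousAt_const (by simpa [h0] using hη0)
  obtain ⟨r₁, hr₁, hball⟩ := Metric.eventually_nhds_iff.1 hev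
  set r := min r₁ (η / (2 * B)) with hr
  have hr0 : 0 < r := by positivity
  refine ⟨κ ^ 2 / 8, by positivity, r, hr0, fun c hc => ?_⟩
  have hmem : ∀ t ∈ Metric.ball p.1 r, (t, c) ∈ U ∧ DifferentiableAt ℝ φ (t, c) ∧
      dist (fderiv ℝ φ (t, c)) (fderiv ℝ φ p) < κ / 2 ∧ ‖φ (t, c)‖ < η := fun t ht => by
    refine hball ?_
    rw [Prod.dist_eq]
    exact max_lt (lt_of_lt_of_le ht (min_le_left _ _)) (lt_of_lt_of_le hc (min_le_left _ _))
  refine strongConvexOn_of_forall_exists_linear_minorant (convex_ball _ _) fun z hz => ?_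
  obtain ⟨hzU, -, hzD, hzη⟩ := hmem z hz
  set D : V → V →L[ℝ] F := fun t => (fderiv ℝ φ (t, c)).comp (ContinuousLinearMap.inl ℝ V W)
  have hderiv : ∀ t ∈ Metric.ball p.1 r, HasFDerivAt (fun t => φ (t, c)) (D t) t := fun t ht =>
    ((hmem t ht).2.1.hasFDerivAt).comp t (hasFDerivAt_prodMk_left t c)
  refine ⟨((innerSL ℝ (φ (z, c))).comp (D z) : V →L[ℝ] ℝ), fun x hx => ?_⟩
  set h := x - z with hh
  set R := φ (x, c) - φ (z, c) - D z h with hR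
  have hRle : ‖R‖ ≤ K * ‖h‖ * ‖h‖ := by
    have hseg : segment ℝ z x ⊆ Metric.ball p.1 r := (convex_ball _ _).segment_subset hz hx
    refine (convex_segment z x).norm_image_sub_le_of_norm_hasFDerivWithin_le'
      (f := fun t => φ (t, c)) (f' := D)
      (fun t ht => (hderiv t (hseg ht)).hasFDerivWithinAt) (fun t ht => ?_)
      (left_mem_segment ℝ z x) (right_mem_segment ℝ z x)
    have h1 : ‖D t - D z‖ ≤ ‖fderiv ℝ φ (t, c) - fderiv ℝ φ (z, c)‖ := by
      refine ContinuousLinearMap.opNorm_le_bound _ (norm_nonneg _) fun u => ?_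
      have := (fderiv ℝ φ (t, c) - fderiv ℝ φ (z, c)).le_opNorm (u, 0)
      simpa [D] using this
    refine h1.trans ?_
    have h2 := hLip.dist_le_mul (t, c) (hmem t (hseg ht)).1 (z, c) hzU
    rw [dist_eq_norm, Prod.dist_eq] at h2
    simp only [dist_self, dist_nonneg, sup_of_le_left] at h2
    refine h2.trans ?_
    gcongr
    rw [dist_eq_norm, hh]
    exact norm_sub_le_of_mem_segment ht
  have hdiff : ‖D z h - fderiv ℝ φ p (h, 0)‖ ≤ κ / 2 * ‖h‖ := by
    have := (fderiv ℝ φ (z, c) - fderiv ℝ φ p).le_opNorm (h, 0)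
    rw [← dist_eq_norm] at this
    have hn : ‖((h, 0) : V × W)‖ = ‖h‖ := by simp
    rw [hn] at this
    refine le_trans ?_ (this.trans (by gcongr))
    simp [D]
  have hDlow : κ / 2 * ‖h‖ ≤ ‖D z h‖ := by
    have h1 := hinj h
    have h2 := norm_sub_norm_le (fderiv ℝ φ p (h, 0)) (D z h)
    rw [norm_sub_rev] at h2
    linarith
  have hDup : ‖D z h‖ ≤ B * ‖h‖ := by
    have h1 := norm_sub_norm_le (D z h) (fderiv ℝ φ p (h, 0))
    have h2 := (fderiv ℝ φ p).le_opNorm (h, 0)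
    have hn : ‖((h, 0) : V × W)‖ = ‖h‖ := by simp
    rw [hn] at h2
    rw [hB]
    linarith
  have hhr : B * ‖h‖ ≤ η := by
    have h1 : ‖h‖ ≤ r + r := by
      have hx' := Metric.mem_ball.1 hx
      have hz' := Metric.mem_ball.1 hz
      rw [hh, ← dist_eq_norm]
      linarith [dist_triangle_right x z p.1]
    have h2 : r ≤ η / (2 * B) := min_le_right _ _
    have h3 : B * (η / (2 * B) + η / (2 * B)) = η := by field_simp; norm_num
    calc B * ‖h‖ ≤ B * (η / (2 * B) + η / (2 * B)) := by gcongr; linarith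
      _ = η := h3
  have hx_eq : φ (x, c) = φ (z, c) + D z h + R := by rw [hR]; abel
  have hexp : ‖φ (x, c)‖ ^ 2 = ‖φ (z, c)‖ ^ 2 + 2 * inner ℝ (φ (z, c)) (D z h) + ‖D z h‖ ^ 2 +
      2 * inner ℝ (φ (z, c) + D z h) R + ‖R‖ ^ 2 := by
    rw [hx_eq, norm_add_sq_real, norm_add_sq_real]
  have hin : -((η + η) * (K * ‖h‖ * ‖h‖)) ≤ inner ℝ (φ (z, c) + D z h) R := by
    have h1 := neg_le_of_abs_le (abs_real_inner_le_norm (φ (z, c) + D z h) R)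
    refine le_trans (neg_le_neg ?_) h1
    gcongr
    exact (norm_add_le _ _).trans (add_le_add hzη.le (hDup.trans hhr))
  have hηK : (η + η) * K ≤ κ ^ 2 / 16 := by
    have : (K : ℝ) / (K + 1) ≤ 1 := by
      rw [div_le_one (by positivity)]
      linarith
    calc (η + η) * K = κ ^ 2 / 16 * (K / (K + 1)) := by rw [hη]; field_simp; ring
      _ ≤ κ ^ 2 / 16 * 1 := by gcongr
      _ = _ := mul_one _
  have hsq : κ ^ 2 / 4 * ‖h‖ ^ 2 ≤ ‖D z h‖ ^ 2 := by
    calc _ = (κ / 2 * ‖h‖) ^ 2 := by ring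
      _ ≤ _ := by gcongr
  have hηK' := mul_le_mul_of_nonneg_right hηK (sq_nonneg ‖h‖)
  have hl : ((innerSL ℝ (φ (z, c))).comp (D z) : V →L[ℝ] ℝ) h = inner ℝ (φ (z, c)) (D z h) := rfl
  simp only [ContinuousLinearMap.coe_coe, hl, hexp]
  nlinarith [sq_nonneg ‖R‖]

end StrongConvexity

section StageTwo

variable {d q n : ℕ} {k : E d → E d → E q → ℝ} {x : Fin n → E d}

/-- The fitted variance is the best nonnegative multiplier of the correlation vector. -/
theorem stageTwoObj_le (c : LongVec n) {t : E q} (ht : corrVec k x t ≠ 0) {v : ℝ} (hv : 0 ≤ v) :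
    stageTwoObj k x c t ≤ 1 / 2 * ‖v • corrVec k x t - c‖ ^ 2 := by
  unfold stageTwoObj fitVar
  set r := corrVec k x t
  have hr : 0 < ‖r‖ ^ 2 := by positivity
  have hexp : ∀ u : ℝ, ‖u • r - c‖ ^ 2 = u ^ 2 * ‖r‖ ^ 2 - 2 * u * inner ℝ r c + ‖c‖ ^ 2 :=
    fun u => by
      rw [norm_sub_sq_real, norm_smul, mul_pow, Real.norm_eq_abs, sq_abs, real_inner_smul_left]
      ring
  rw [hexp, hexp]
  rcases le_total 0 (inner ℝ r c / ‖r‖ ^ 2) with h | h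
  · rw [max_eq_right h]
    have hβ : inner ℝ r c = inner ℝ r c / ‖r‖ ^ 2 * ‖r‖ ^ 2 := by field_simp
    set w := inner ℝ r c / ‖r‖ ^ 2
    rw [hβ]
    nlinarith [mul_nonneg hr.le (sq_nonneg (v - w))]
  · rw [max_eq_left h]
    have hβ : inner ℝ r c ≤ 0 := by
      by_contra hcon
      exact absurd h (not_le.2 (div_pos (not_le.1 hcon) hr))
    nlinarith [mul_nonneg (sq_nonneg v) hr.le, mul_nonneg hv (neg_nonneg.2 hβ)]

/-- Parameters that fit `c` at least as well as `t₀` fit `v • r(t₀)`, which is close to `c`. -/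
theorem norm_fit_sub_le {c : LongVec n} {t₀ t : E q} {v : ℝ} (hv : 0 ≤ v)
    (h0 : corrVec k x t₀ ≠ 0) (hle : stageTwoObj k x c t ≤ stageTwoObj k x c t₀) :
    ‖fitVar k x c t • corrVec k x t - v • corrVec k x t₀‖ ≤
      2 * ‖c - v • corrVec k x t₀‖ := by
  have h1 := hle.trans (stageTwoObj_le c h0 hv)
  unfold stageTwoObj at h1
  have h2 : ‖fitVar k x c t • corrVec k x t - c‖ ≤ ‖v • corrVec k x t₀ - c‖ :=
    le_of_sq_le_sq (by linarith) (norm_nonneg _)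
  rw [norm_sub_rev (v • _)] at h2
  have h3 := norm_sub_le_norm_sub_add_norm_sub (fitVar k x c t • corrVec k x t) c
    (v • corrVec k x t₀)
  linarith

theorem abs_fitVar_sub_le {c : LongVec n} {t₀ t : E q} {v : ℝ} (i : Fin n) (hv : 0 ≤ v)
    (h0 : corrVec k x t₀ ≠ 0) (hi₀ : corrVec k x t₀ (i, i) = 1) (hi : corrVec k x t (i, i) = 1)
    (hle : stageTwoObj k x c t ≤ stageTwoObj k x c t₀) :
    |fitVar k x c t - v| ≤ 2 * ‖c - v • corrVec k x t₀‖ := by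
  have h := PiLp.norm_apply_le (fitVar k x c t • corrVec k x t - v • corrVec k x t₀) (i, i)
  simp only [PiLp.sub_apply, PiLp.smul_apply, hi, hi₀, smul_eq_mul, mul_one] at h
  exact h.trans (norm_fit_sub_le hv h0 hle)

/-- The correlation vector of a parameter that fits `c` well is close to the true one. -/
theorem norm_corrVec_sub_le {c : LongVec n} {t₀ t : E q} {v : ℝ} (i : Fin n) (hv : 0 < v)
    (h0 : corrVec k x t₀ ≠ 0) (hi₀ : corrVec k x t₀ (i, i) = 1) (hi : corrVec k x t (i, i) = 1)
    (hle : stageTwoObj k x c t ≤ stageTwoObj k x c t₀)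
    (hc : ‖c - v • corrVec k x t₀‖ ≤ v / 4) :
    ‖corrVec k x t - corrVec k x t₀‖ ≤
      2 * (2 + 2 * ‖corrVec k x t₀‖) / v * ‖c - v • corrVec k x t₀‖ := by
  have h1 := norm_fit_sub_le hv.le h0 hle
  have h2 := abs_fitVar_sub_le i hv.le h0 hi₀ hi hle
  set e := ‖c - v • corrVec k x t₀‖
  set w := fitVar k x c t
  have hw : v / 2 ≤ w := by linarith [(abs_le.1 h2).1]
  have hw0 : 0 < w := by linarith
  have heq : w • (corrVec k x t - corrVec k x t₀) =
      (w • corrVec k x t - v • corrVec k x t₀) - (w - v) • corrVec k x t₀ := by module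
  have h3 : w * ‖corrVec k x t - corrVec k x t₀‖ ≤ 2 * e + 2 * e * ‖corrVec k x t₀‖ := by
    have : w * ‖corrVec k x t - corrVec k x t₀‖ = ‖w • (corrVec k x t - corrVec k x t₀)‖ := by
      rw [norm_smul, Real.norm_eq_abs, abs_of_pos hw0]
    rw [this, heq]
    refine (norm_sub_le _ _).trans ?_
    rw [norm_smul, Real.norm_eq_abs]
    gcongr
  have h4 := mul_le_mul_of_nonneg_right hw (norm_nonneg (corrVec k x t - corrVec k x t₀))
  rw [div_mul_eq_mul_div, le_div_iff₀ hv]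
  linarith

/-- Injectivity of the derivative of the correlation vector modulo the vector itself. -/
theorem eq_zero_of_fderiv_add_smul_eq_zero {r : LongVec n} {D : E q →L[ℝ] LongVec n}
    (hli : LinearIndependent ℝ (Fin.cons r
      (fun j : Fin q => D (EuclideanSpace.single j (1 : ℝ))) : Fin (q + 1) → LongVec n))
    {h : E q} {s : ℝ} (hz : D h + s • r = 0) : h = 0 := by
  have hsum : D h = ∑ j, h j • D (EuclideanSpace.single j (1 : ℝ)) := by
    conv_lhs => rw [← (EuclideanSpace.basisFun (Fin q) ℝ).sum_repr h]
    simp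
  rw [Fintype.linearIndependent_iff] at hli
  have := hli (Fin.cons s fun j => h j) (by
    rw [Fin.sum_univ_succ]
    simp only [Fin.cons_zero, Fin.cons_succ]
    rw [← hsum, add_comm, hz])
  ext j
  simpa using this j.succ

/-- A map whose derivative at `t₀` is injective separates points from `t₀` linearly. -/
theorem exists_norm_sub_le_of_injective_fderiv {V F : Type*} [NormedAddCommGroup V]
    [NormedSpace ℝ V] [FiniteDimensional ℝ V] [NormedAddCommGroup F] [NormedSpace ℝ F]
    {f : V → F} {D : V →L[ℝ] F} {t₀ : V} (hf : HasFDerivAt f D t₀) (hD : ∀ h, D h = 0 → h = 0) :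
    ∃ L > 0, ∀ᶠ t in nhds t₀, ‖t - t₀‖ ≤ L * ‖f t - f t₀‖ := by
  obtain ⟨K, hK, hanti⟩ := (D : V →ₗ[ℝ] F).exists_antilipschitzWith (LinearMap.ker_eq_bot'.2 hD)
  have hK' : (0 : ℝ) < K := hK
  refine ⟨2 * K, by positivity, ?_⟩
  filter_upwards [hf.isLittleO.def (c := 1 / (2 * K)) (by positivity)] with t ht
  have h1 : ‖t - t₀‖ ≤ K * ‖D (t - t₀)‖ := hanti.le_mul_norm (map_zero _) (t - t₀)
  have h2 : ‖D (t - t₀)‖ ≤ ‖f t - f t₀‖ + 1 / (2 * K) * ‖t - t₀‖ := by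
    have h3 := norm_sub_norm_le (D (t - t₀)) (f t - f t₀)
    rw [norm_sub_rev (D _)] at h3
    linarith
  have h4 := mul_le_mul_of_nonneg_left h2 hK'.le
  have h5 : (K : ℝ) * (‖f t - f t₀‖ + 1 / (2 * K) * ‖t - t₀‖) =
      K * ‖f t - f t₀‖ + ‖t - t₀‖ / 2 := by field_simp
  linarith

/-- The Stage-II objective is strongly convex near the truth, for all data near the truth. -/
theorem exists_strongConvexOn_stageTwoObj {t₀ : E q} {v : ℝ} (hv : 0 < v)
    (hr : ContDiffAt ℝ 2 (corrVec k x) t₀)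
    (hli : LinearIndependent ℝ (Fin.cons (corrVec k x t₀)
      (fun j : Fin q => fderiv ℝ (corrVec k x) t₀ (EuclideanSpace.single j (1 : ℝ))) :
        Fin (q + 1) → LongVec n)) :
    ∃ m > 0, ∃ r > 0, ∀ c ∈ Metric.ball (v • corrVec k x t₀) r,
      StrongConvexOn (Metric.ball t₀ r) m (stageTwoObj k x c) := by
  have h0 : corrVec k x t₀ ≠ 0 := by simpa using hli.ne_zero 0
  set r₀ := corrVec k x t₀ with hr₀
  set p : E q × LongVec n := (t₀, v • r₀) with hp
  have hrp : ContDiffAt ℝ 2 (fun z : E q × LongVec n => corrVec k x z.1) p :=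
    ContDiffAt.comp p (f := Prod.fst) (by simpa [hp] using hr) contDiffAt_fst
  set w : E q × LongVec n → ℝ :=
    fun z => inner ℝ (corrVec k x z.1) z.2 / ‖corrVec k x z.1‖ ^ 2 with hw
  have hwC : ContDiffAt ℝ 2 w p :=
    (hrp.inner ℝ contDiffAt_snd).div (hrp.norm_sq ℝ) (by simpa [hp] using h0)
  have hwp : w p = v := by
    have : ‖r₀‖ ^ 2 ≠ 0 := by positivity
    simp only [hw, hp, ← hr₀, real_inner_smul_right, real_inner_self_eq_norm_sq]
    field_simp
  set φ : E q × LongVec n → LongVec n := fun z => w z • corrVec k x z.1 - z.2 with hφ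
  have hφC : ContDiffAt ℝ 2 φ p := (hwC.smul hrp).sub contDiffAt_snd
  have hφp : φ p = 0 := by
    change w p • r₀ - v • r₀ = 0
    rw [hwp, sub_self]
  have hφD : ∀ h, fderiv ℝ φ p (h, 0) =
      v • fderiv ℝ (corrVec k x) t₀ h + fderiv ℝ w p (h, 0) • r₀ := fun h => by
    have hrD : HasFDerivAt (fun z : E q × LongVec n => corrVec k x z.1)
        ((fderiv ℝ (corrVec k x) t₀).comp (ContinuousLinearMap.fst ℝ (E q) (LongVec n))) p :=
      HasFDerivAt.comp p (f := Prod.fst) (hr.differentiableAt (by simp)).hasFDerivAt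
        hasFDerivAt_fst
    have hD : HasFDerivAt φ _ p :=
      ((hwC.differentiableAt (by simp)).hasFDerivAt.smul hrD).sub hasFDerivAt_snd
    rw [hD.fderiv, hwp]
    simp [hp, ← hr₀]
  have hinj : ∀ h, (fderiv ℝ φ p).comp (ContinuousLinearMap.inl ℝ (E q) (LongVec n)) h = 0 →
      h = 0 := fun h hz => by
    have h1 : fderiv ℝ φ p (h, 0) = 0 := hz
    rw [hφD, ← map_smul] at h1
    exact (smul_eq_zero.1 (eq_zero_of_fderiv_add_smul_eq_zero hli h1)).resolve_left hv.ne'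
  obtain ⟨K, hK, hanti⟩ := LinearMap.exists_antilipschitzWith
    ((fderiv ℝ φ p).comp (ContinuousLinearMap.inl ℝ (E q) (LongVec n)) : E q →ₗ[ℝ] LongVec n)
    (LinearMap.ker_eq_bot'.2 hinj)
  have hK' : (0 : ℝ) < K := hK
  obtain ⟨m, hm, r, hrpos, hsc⟩ := exists_strongConvexOn_half_norm_sq hφC hφp
    (κ := 1 / K) (by positivity) fun h => by
      have h1 : ‖h‖ ≤ K * ‖fderiv ℝ φ p (h, 0)‖ := hanti.le_mul_norm (map_zero _) h
      rw [one_div, inv_mul_le_iff₀ hK']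
      exact h1
  obtain ⟨r', hr', hwpos⟩ := Metric.eventually_nhds_iff.1
    (continuousAt_const.eventually_lt hwC.continuousAt (show (0 : ℝ) < w p by rwa [hwp]))
  refine ⟨m, hm, min r r', lt_min hrpos hr', fun c hc => ?_⟩
  have hsc' := hsc c (Metric.ball_subset_ball (min_le_left _ _) hc)
  have hobj : ∀ t ∈ Metric.ball t₀ (min r r'),
      stageTwoObj k x c t = 1 / 2 * ‖φ (t, c)‖ ^ 2 := fun t ht => by
    have : 0 < w (t, c) := hwpos (by
      rw [Prod.dist_eq]
      exact max_lt (lt_of_lt_of_le ht (min_le_right _ _))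
        (lt_of_lt_of_le hc (min_le_right _ _)))
    have hfit : fitVar k x c t = w (t, c) := max_eq_right this.le
    rw [stageTwoObj, hfit]
  have hconv := convex_ball t₀ (min r r')
  refine ⟨hconv, fun y hy z hz a b ha hb hab => ?_⟩
  rw [hobj y hy, hobj z hz, hobj _ (hconv hy hz ha hb hab)]
  exact hsc'.2 (Metric.ball_subset_ball (min_le_left _ _) hy)
    (Metric.ball_subset_ball (min_le_left _ _) hz) ha hb hab

/-- Stage II has a solution for all data near the truth; its solutions depend on the data in a
Lipschitz way at the truth, and the objective is strongly convex around them. -/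
theorem exists_stageTwo_rate {Θρ : Set (E q)} (i : Fin n)
    (hdiag : ∀ t ∈ Θρ, corrVec k x t (i, i) = 1)
    {θ : Param q} (hρ : θ.fst ∈ interior Θρ) (hv : 0 < θ.snd)
    (hid : IdentifiableAt k x Θρ θ.fst)
    (hr : ContDiffOn ℝ 2 (corrVec k x) (interior Θρ))
    (hli : LinearIndependent ℝ (Fin.cons (corrVec k x θ.fst)
      (fun j : Fin q => fderiv ℝ (corrVec k x) θ.fst (EuclideanSpace.single j (1 : ℝ))) :
        Fin (q + 1) → LongVec n)) :
    ∃ ρ > 0, ∃ L > 0, ∃ m > 0, ∃ δ > 0, ∀ c : LongVec n,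
      ‖c - θ.snd • corrVec k x θ.fst‖ ≤ ρ →
      (∃ θhat, IsStageTwo k x Θρ c θhat) ∧
      ∀ θhat, IsStageTwo k x Θρ c θhat →
        ‖θhat - θ‖ ≤ L * ‖c - θ.snd • corrVec k x θ.fst‖ ∧
        StrongConvexOn (Metric.ball θhat.fst δ) m (stageTwoObj k x c) := by
  set t₀ := θ.fst
  set v := θ.snd
  have hne : ∀ t ∈ Θρ, corrVec k x t ≠ 0 := fun t ht h => by
    have := hdiag t ht
    rw [h] at this
    simp at this
  have ht₀ : t₀ ∈ Θρ := interior_subset hρ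
  have hrt : ContDiffAt ℝ 2 (corrVec k x) t₀ := hr.contDiffAt (isOpen_interior.mem_nhds hρ)
  obtain ⟨m, hm, r₁, hr₁, hsc⟩ := exists_strongConvexOn_stageTwoObj hv hrt hli
  obtain ⟨L₁, hL₁, hsep⟩ := exists_norm_sub_le_of_injective_fderiv
    (hrt.differentiableAt (by simp)).hasFDerivAt
    (fun h hz => eq_zero_of_fderiv_add_smul_eq_zero hli (s := 0) (by rw [hz]; simp))
  obtain ⟨r₂, hr₂, hsep'⟩ := Metric.eventually_nhds_iff.1
    (hsep.and (isOpen_interior.mem_nhds hρ))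
  set r := min r₁ r₂
  have hr0 : 0 < r := lt_min hr₁ hr₂
  obtain ⟨η, hη, hidη⟩ := hid (r / 2) (by positivity)
  set M := 2 * (2 + 2 * ‖corrVec k x t₀‖) / v with hM
  have hM0 : 0 < M := by positivity
  have hclose : ∀ c : LongVec n, ‖c - v • corrVec k x t₀‖ ≤ v / 4 →
      ‖c - v • corrVec k x t₀‖ ≤ η / M → ∀ t ∈ Θρ,
      stageTwoObj k x c t ≤ stageTwoObj k x c t₀ → ‖t - t₀‖ ≤ r / 2 ∧
        ‖t - t₀‖ ≤ L₁ * M * ‖c - v • corrVec k x t₀‖ := fun c hc hc' t ht hle => by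
    have h1 := norm_corrVec_sub_le i hv (hne t₀ ht₀) (hdiag t₀ ht₀) (hdiag t ht) hle hc
    rw [← hM] at h1
    have h2 : ‖t - t₀‖ ≤ r / 2 := hidη t ht (h1.trans (by
      rwa [le_div_iff₀' hM0] at hc'))
    refine ⟨h2, ?_⟩
    have h3 : dist t t₀ < r₂ := by
      rw [dist_eq_norm]
      linarith [min_le_right r₁ r₂]
    refine (hsep' h3).1.trans ?_
    rw [mul_assoc]
    gcongr
  have hballΘ : Metric.closedBall t₀ (r / 2) ⊆ interior Θρ := fun t ht =>
    (hsep' (lt_of_le_of_lt ht (by linarith [min_le_right r₁ r₂]))).2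
  refine ⟨min (v / 4) (min (η / M) (r / 2)), by positivity, L₁ * M + 2, by positivity, m, hm,
    r / 2, by positivity, fun c hc => ?_⟩
  have hc1 : ‖c - v • corrVec k x t₀‖ ≤ v / 4 := hc.trans (min_le_left _ _)
  have hc2 : ‖c - v • corrVec k x t₀‖ ≤ η / M :=
    hc.trans ((min_le_right _ _).trans (min_le_left _ _))
  have hc3 : ‖c - v • corrVec k x t₀‖ ≤ r / 2 :=
    hc.trans ((min_le_right _ _).trans (min_le_right _ _))
  refine ⟨?_, fun θhat hθ => ?_⟩
  · have hcont : ContinuousOn (stageTwoObj k x c) (Metric.closedBall t₀ (r / 2)) := by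
      have hrc : ContinuousOn (corrVec k x) (Metric.closedBall t₀ (r / 2)) :=
        hr.continuousOn.mono hballΘ
      have hfit : ContinuousOn (fitVar k x c) (Metric.closedBall t₀ (r / 2)) := by
        refine continuousOn_const.sup ((hrc.inner continuousOn_const).div (hrc.norm.pow 2) ?_)
        intro t ht
        have := hne t (interior_subset (hballΘ ht))
        positivity
      exact continuousOn_const.mul (((hfit.smul hrc).sub continuousOn_const).norm.pow 2)
    obtain ⟨t, ht, hmin⟩ := (isCompact_closedBall t₀ (r / 2)).exists_isMinOn
      ⟨t₀, Metric.mem_closedBall_self (by positivity)⟩ hcont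
    refine ⟨WithLp.toLp 2 (t, fitVar k x c t), interior_subset (hballΘ ht), fun u hu => ?_, rfl⟩
    have ht₀le : stageTwoObj k x c t ≤ stageTwoObj k x c t₀ :=
      hmin (Metric.mem_closedBall_self (by positivity))
    change stageTwoObj k x c t ≤ stageTwoObj k x c u
    rcases le_total (stageTwoObj k x c u) (stageTwoObj k x c t₀) with h | h
    · exact hmin (by
        rw [Metric.mem_closedBall, dist_eq_norm]
        exact (hclose c hc1 hc2 u hu h).1)
    · exact ht₀le.trans h
  · obtain ⟨hΘ, hmin, hvar⟩ := hθ
    have hle : stageTwoObj k x c θhat.fst ≤ stageTwoObj k x c t₀ := hmin ht₀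
    obtain ⟨hd1, hd2⟩ := hclose c hc1 hc2 _ hΘ hle
    have hvv := abs_fitVar_sub_le i hv.le (hne t₀ ht₀) (hdiag t₀ ht₀) (hdiag _ hΘ) hle
    rw [← hvar] at hvv
    constructor
    · have hn : ‖θhat - θ‖ ≤ ‖θhat.fst - t₀‖ + |θhat.snd - v| := by
        rw [WithLp.prod_norm_eq_of_L2]
        refine Real.sqrt_le_iff.2 ⟨by positivity, ?_⟩
        simp only [WithLp.sub_fst, WithLp.sub_snd, Real.norm_eq_abs]
        nlinarith [norm_nonneg (θhat.fst - t₀), abs_nonneg (θhat.snd - v),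
          mul_nonneg (norm_nonneg (θhat.fst - t₀)) (abs_nonneg (θhat.snd - v))]
      linarith
    · have hs := hsc c (by
        rw [Metric.mem_ball, dist_eq_norm]
        linarith [min_le_left r₁ r₂])
      have hsub : Metric.ball θhat.fst (r / 2) ⊆ Metric.ball t₀ r₁ := by
        refine Metric.ball_subset_ball' ?_
        rw [dist_eq_norm]
        linarith [min_le_left r₁ r₂]
      exact ⟨convex_ball _ _, fun y hy z hz => hs.2 (hsub hy) (hsub hz)⟩

end StageTwo

section Chernoff

variable {𝓧 : Type*} [MeasurableSpace 𝓧] {ν : Measure 𝓧} [IsProbabilityMeasure ν] {g : 𝓧 → ℝ}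

/-- The moment generating function of a centered variable with exponential moments is
sub-Gaussian near `0`. -/
theorem exists_mgf_le_exp_sq (hg : 0 ∈ interior (integrableExpSet g ν)) (hmean : ν[g] = 0) :
    ∃ V > 0, ∀ s, 0 < s → s ≤ 1 / V →
      Integrable (fun ω => Real.exp (s * g ω)) ν ∧ mgf g ν s ≤ Real.exp (V * s ^ 2) := by
  have hcont : ContinuousAt (iteratedDeriv 2 (cgf g ν)) 0 := by
    rw [iteratedDeriv_succ, iteratedDeriv_one]
    exact (analyticAt_cgf hg).deriv.deriv.continuousAt
  have hev : ∀ᶠ u in nhds (0 : ℝ), u ∈ interior (integrableExpSet g ν) ∧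
      iteratedDeriv 2 (cgf g ν) u < iteratedDeriv 2 (cgf g ν) 0 + 1 :=
    Filter.Eventually.and (isOpen_interior.mem_nhds hg) (hcont.eventually_lt continuousAt_const (by simp))
  obtain ⟨r, hr, hball⟩ := Metric.eventually_nhds_iff.1 hev
  set c := |iteratedDeriv 2 (cgf g ν) 0 + 1|
  have hV : 0 < c + 2 / r := by positivity
  refine ⟨c + 2 / r, hV, fun s hs hsV => ?_⟩
  have hsr : s < r := by
    have h1 : 1 / (c + 2 / r) ≤ 1 / (2 / r) := by
      gcongr
      linarith [abs_nonneg (iteratedDeriv 2 (cgf g ν) 0 + 1)]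
    have h2 : 1 / (2 / r) = r / 2 := by simp
    linarith
  have hin : ∀ u ∈ Set.Icc 0 s, u ∈ interior (integrableExpSet g ν) ∧
      iteratedDeriv 2 (cgf g ν) u < iteratedDeriv 2 (cgf g ν) 0 + 1 := fun u hu =>
    hball (by rw [Real.dist_eq, sub_zero, abs_of_nonneg hu.1]; exact hu.2.trans_lt hsr)
  obtain ⟨u, hu, hcgf⟩ := exists_cgf_eq_iteratedDeriv_two_cgf_mul hs hmean fun v hv => (hin v hv).1
  have hint : Integrable (fun ω => Real.exp (s * g ω)) ν :=
    integrable_of_mem_integrableExpSet (interior_subset (hin s ⟨hs.le, le_rfl⟩).1)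
  refine ⟨hint, ?_⟩
  rw [← exp_cgf hint, hcgf]
  have h3 : iteratedDeriv 2 (cgf g ν) u ≤ c :=
    (hin u ⟨hu.1.le, hu.2.le⟩).2.le.trans (le_abs_self _)
  have h4 : 0 ≤ 2 / r := by positivity
  have h5 : 0 ≤ c := abs_nonneg _
  refine Real.exp_le_exp.2 ?_
  nlinarith [mul_le_mul_of_nonneg_right h3 (sq_nonneg s), mul_nonneg h4 (sq_nonneg s),
    mul_nonneg h5 (sq_nonneg s)]

/-- Chernoff bound for sums of independent copies of a centered variable with exponential
moments. -/
theorem exists_chernoff_bound (hgm : Measurable g) (hg : 0 ∈ interior (integrableExpSet g ν))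
    (hmean : ν[g] = 0) :
    ∃ U > 0, ∀ (N : ℕ) (t : ℝ), 0 < t → t ≤ 1 / U →
      ∀ (Ω : Type*) [MeasurableSpace Ω] (μ : Measure Ω) [IsProbabilityMeasure μ]
        (y : Fin N → Ω → 𝓧), iIndepFun y μ → (∀ s, HasLaw (y s) ν μ) →
        μ.real {ω | N * t ≤ ∑ s, g (y s ω)} ≤ Real.exp (-(N * t ^ 2 / U)) := by
  obtain ⟨V, hV, hmgf⟩ := exists_mgf_le_exp_sq hg hmean
  refine ⟨4 * V + 1, by positivity, fun N t ht htU Ω _ μ _ y hind hlaw => ?_⟩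
  have ht1 : t ≤ 1 := htU.trans (by rw [div_le_one (by positivity)]; linarith)
  set s := t / (2 * V) with hs
  have hs0 : 0 < s := by positivity
  have hsV : s ≤ 1 / V := by
    rw [hs, div_le_div_iff₀ (by positivity) hV]
    nlinarith
  obtain ⟨hint, hle⟩ := hmgf s hs0 hsV
  have hmeas : ∀ i, AEMeasurable (fun ω => g (y i ω)) μ := fun i =>
    hgm.comp_aemeasurable (hlaw i).aemeasurable
  have hind' : iIndepFun (fun i ω => g (y i ω)) μ := hind.comp (fun _ => g) fun _ => hgm
  have hone : ∀ i, mgf (fun ω => g (y i ω)) μ s = mgf g ν s := fun i => by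
    rw [← (hlaw i).map_eq, mgf_map (hlaw i).aemeasurable]
    · rfl
    · exact (by fun_prop : Measurable fun ω => Real.exp (s * g ω)).aestronglyMeasurable
  have hsum : mgf (∑ i, fun ω => g (y i ω)) μ s = mgf g ν s ^ N := by
    rw [hind'.mgf_sum₀ hmeas]
    simp [hone]
  have hsint : Integrable (fun ω => Real.exp (s * (∑ i, fun ω => g (y i ω)) ω)) μ := by
    by_contra h
    have h0 : mgf (∑ i, fun ω => g (y i ω)) μ s = 0 := mgf_undef h
    rw [hsum] at h0
    exact (pow_pos (mgf_pos hint) N).ne' h0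
  have hch := measure_ge_le_exp_mul_mgf (N * t) hs0.le hsint
  simp only [Finset.sum_apply] at hch
  refine hch.trans ?_
  rw [hsum]
  calc _ ≤ Real.exp (-s * (N * t)) * Real.exp (V * s ^ 2) ^ N := by
        gcongr
        exact mgf_nonneg
    _ = Real.exp (-(N * t ^ 2 / (4 * V))) := by
        rw [← Real.exp_nat_mul, ← Real.exp_add, hs]
        congr 1
        field_simp
        ring
    _ ≤ _ := by
        gcongr
        linarith

end Chernoff

section Gaussian

variable {n : ℕ} {C : Matrix (Fin n) (Fin n) ℝ}

theorem integral_eval_mul_eval_multivariateGaussian (hC : C.PosSemidef) (i j : Fin n) :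
    ∫ z : E n, z i * z j ∂(multivariateGaussian 0 C) = C i j := by
  have hmean : ∀ i, ∫ z : E n, z i ∂(multivariateGaussian 0 C) = 0 := fun i => by
    have h := (EuclideanSpace.proj i : E n →L[ℝ] ℝ).integral_comp_comm
      (μ := multivariateGaussian 0 C) (φ := fun z : E n => z) IsGaussian.integrable_id
    simpa using h
  rw [← covariance_eval_multivariateGaussian (μ := 0) hC i j, covariance]
  simp [hmean]

theorem zero_mem_interior_integrableExpSet_eval_mul_eval (i j : Fin n) (σ m : ℝ) :
    0 ∈ interior (integrableExpSet (fun z : E n => σ * (z i * z j - m))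
      (multivariateGaussian 0 C)) := by
  obtain ⟨c, hc, hint⟩ := IsGaussian.exists_integrable_exp_sq (multivariateGaussian 0 C)
  rw [mem_interior_iff_mem_nhds]
  refine Filter.mem_of_superset (Metric.ball_mem_nhds 0 (ε := c / (|σ| + 1)) (by positivity)) ?_
  intro s hs
  have hsσ : |s * σ| ≤ c := by
    rw [mem_ball_zero_iff, Real.norm_eq_abs, lt_div_iff₀ (by positivity)] at hs
    rw [abs_mul]
    nlinarith [abs_nonneg s]
  refine (hint.mul_const (Real.exp (-(s * σ * m)))).mono' (by fun_prop)
    (Filter.Eventually.of_forall fun z => ?_)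
  rw [Real.norm_eq_abs, Real.abs_exp, ← Real.exp_add]
  refine Real.exp_le_exp.2 ?_
  have hz : |z i * z j| ≤ ‖z‖ ^ 2 := by
    rw [abs_mul, sq]
    gcongr
    · exact PiLp.norm_apply_le z i
    · exact PiLp.norm_apply_le z j
  have : s * σ * (z i * z j) ≤ c * ‖z‖ ^ 2 := by
    refine (le_abs_self _).trans ?_
    rw [abs_mul]
    gcongr
  linarith

theorem exists_chernoff_bound_eval_mul_eval (hC : C.PosSemidef) (i j : Fin n) (σ : ℝ) :
    ∃ U > 0, ∀ (N : ℕ) (t : ℝ), 0 < t → t ≤ 1 / U →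
      ∀ (Ω : Type*) [MeasurableSpace Ω] (μ : Measure Ω) [IsProbabilityMeasure μ]
        (y : Fin N → Ω → E n), iIndepFun y μ →
        (∀ s, HasLaw (y s) (multivariateGaussian 0 C) μ) →
        μ.real {ω | N * t ≤ ∑ s, σ * (y s ω i * y s ω j - C i j)} ≤
          Real.exp (-(N * t ^ 2 / U)) := by
  refine exists_chernoff_bound (g := fun z : E n => σ * (z i * z j - C i j)) (by fun_prop)
    (zero_mem_interior_integrableExpSet_eval_mul_eval i j σ _) ?_
  have hint : Integrable (fun z : E n => z i * z j) (multivariateGaussian 0 C) := by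
    have := integrable_of_mem_interior_integrableExpSet
      (zero_mem_interior_integrableExpSet_eval_mul_eval (C := C) i j 1 0)
    simpa using this
  rw [integral_const_mul, integral_sub hint (integrable_const _),
    integral_eval_mul_eval_multivariateGaussian hC]
  simp

/-- Exponential concentration of the entries of the sample covariance matrix. -/
theorem exists_sampleCov_concentration (hC : C.PosSemidef) :
    ∃ U > 0, ∀ (N : ℕ) (t : ℝ), 0 < N → 0 < t → t ≤ 1 / U →
      ∀ (Ω : Type*) [MeasurableSpace Ω] (μ : Measure Ω) [IsProbabilityMeasure μ]
        (y : Fin N → Ω → E n), iIndepFun y μ →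
        (∀ s, HasLaw (y s) (multivariateGaussian 0 C) μ) →
        μ.real {ω | ∃ i j, t < |sampleCov (fun s => y s ω) i j - C i j|} ≤
          2 * n ^ 2 * Real.exp (-(N * t ^ 2 / U)) := by
  choose U hU hbound using fun p : (Fin n × Fin n) × Bool =>
    exists_chernoff_bound_eval_mul_eval hC p.1.1 p.1.2 (if p.2 then 1 else -1)
  have hUle : ∀ p, U p ≤ ∑ p, U p + 1 := fun p => by
    have := Finset.single_le_sum (f := U) (fun i _ => (hU i).le) (Finset.mem_univ p)
    linarith
  have hU0 : 0 < ∑ p, U p + 1 := by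
    have := Finset.sum_nonneg (s := Finset.univ) fun p _ => (hU p).le
    linarith
  refine ⟨∑ p, U p + 1, hU0, fun N t hN ht htU Ω _ μ _ y hind hlaw => ?_⟩
  have hN' : (0 : ℝ) < N := by exact_mod_cast hN
  have hsub : {ω | ∃ i j, t < |sampleCov (fun s => y s ω) i j - C i j|} ⊆
      ⋃ p : (Fin n × Fin n) × Bool, {ω | N * t ≤ ∑ s, (if p.2 then (1 : ℝ) else -1) *
        (y s ω p.1.1 * y s ω p.1.2 - C p.1.1 p.1.2)} := by
    rintro ω ⟨i, j, hij⟩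
    have hS : ∑ s, (y s ω i * y s ω j - C i j) =
        N * (sampleCov (fun s => y s ω) i j - C i j) := by
      simp only [sampleCov, Matrix.of_apply, Finset.sum_sub_distrib, Finset.sum_const,
        Finset.card_univ, Fintype.card_fin, nsmul_eq_mul]
      field_simp
    rw [Set.mem_iUnion]
    rcases lt_abs.1 hij with h | h
    · refine ⟨((i, j), true), ?_⟩
      simp only [if_true, one_mul, Set.mem_ofPred_eq, hS]
      gcongr
    · refine ⟨((i, j), false), ?_⟩
      simp only [Bool.false_eq_true, if_false, Set.mem_ofPred_eq, ← Finset.mul_sum, hS]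
      have := mul_le_mul_of_nonneg_left h.le hN'.le
      linarith
  calc _ ≤ μ.real _ := measureReal_mono hsub
    _ ≤ ∑ p, μ.real _ := measureReal_iUnion_fintype_le _
    _ ≤ ∑ p : (Fin n × Fin n) × Bool, Real.exp (-(N * t ^ 2 / (∑ p, U p + 1))) := by
        refine Finset.sum_le_sum fun p _ => ?_
        refine (hbound p N t ht (htU.trans ?_) Ω μ y hind hlaw).trans ?_
        · exact one_div_le_one_div_of_le (hU p) (hUle p)
        · have := hU p
          have := hUle p
          gcongr
    _ = _ := by
        simp
        ring

end Gaussian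

theorem longVec_covMatrix {d q n : ℕ} (k : E d → E d → E q → ℝ) (x : Fin n → E d) (θ : Param q) :
    longVec (covMatrix k x θ) = θ.snd • corrVec k x θ.fst := by
  ext p; simp [longVec, covMatrix, corrVec]

theorem norm_longVec_le_of_abs_apply_le {n : ℕ} {A : Matrix (Fin n) (Fin n) ℝ} {t : ℝ}
    (ht : 0 ≤ t) (h : ∀ i j, |A i j| ≤ t) : ‖longVec A‖ ≤ n * t := by
  refine le_of_sq_le_sq ?_ (by positivity)
  rw [norm_longVec_sq]
  calc ∑ i, ∑ j, A i j ^ 2 ≤ ∑ _i : Fin n, ∑ _j : Fin n, t ^ 2 :=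
        Finset.sum_le_sum fun i _ => Finset.sum_le_sum fun j _ => sq_le_sq'
          (abs_le.1 (h i j)).1 (abs_le.1 (h i j)).2
    _ = (n * t) ^ 2 := by simp; ring

theorem one_le_sampleBase {n : ℕ} (hn : 2 ≤ n) {M : ℝ} (hM : 0 < M) : 1 ≤ sampleBase n M := by
  have h1 : 0 ≤ Real.log n := Real.log_nonneg (by exact_mod_cast (by omega : 1 ≤ n))
  have h2 : 0 < Real.log 4 := Real.log_pos (by norm_num)
  exact Nat.one_le_iff_ne_zero.2 (Nat.ceil_pos.2 (by positivity)).ne'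

theorem exists_sampleSize {N₀ : ℕ} (hN₀ : 1 ≤ N₀) {s ε : ℝ} (hs : 0 < s) (hs1 : s ≤ 1)
    (hε : 0 < ε) :
    ∃ N : ℕ, N₀ ≤ N ∧ (N : ℝ) ≤ (1 / s ^ 2 + 1) * N₀ * max 1 (1 / ε ^ 2) ∧
      √((N₀ : ℝ) / N) ≤ s ∧ √((N₀ : ℝ) / N) ≤ s * ε := by
  have hN₀' : (1 : ℝ) ≤ N₀ := by exact_mod_cast hN₀
  set Z := max 1 (1 / ε ^ 2) with hZ
  have hZ1 : 1 ≤ Z := le_max_left _ _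
  have hZε : 1 ≤ Z * ε ^ 2 := by
    have : 1 / ε ^ 2 ≤ Z := le_max_right _ _
    rwa [div_le_iff₀ (by positivity)] at this
  set y := N₀ * Z / s ^ 2 with hy
  have hys : y * s ^ 2 = N₀ * Z := by rw [hy]; field_simp
  have hs2 : s ^ 2 ≤ 1 := pow_le_one₀ hs.le hs1
  have hy0 : 0 < y := by positivity
  have hNZ : (N₀ : ℝ) ≤ N₀ * Z := le_mul_of_one_le_right (by positivity) hZ1
  have hyN : (N₀ : ℝ) ≤ y := by nlinarith
  have hle : y ≤ ⌈y⌉₊ := Nat.le_ceil y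
  have hpos : (0 : ℝ) < ⌈y⌉₊ := hy0.trans_le hle
  have hmul : N₀ * Z ≤ s ^ 2 * ⌈y⌉₊ := by
    rw [← hys, mul_comm]
    gcongr
  refine ⟨⌈y⌉₊, by exact_mod_cast hyN.trans hle, ?_, ?_, ?_⟩
  · calc (⌈y⌉₊ : ℝ) ≤ y + 1 := (Nat.ceil_lt_add_one hy0.le).le
      _ ≤ y + N₀ * Z := by linarith
      _ = _ := by rw [hy]; ring
  · refine Real.sqrt_le_iff.2 ⟨hs.le, ?_⟩
    rw [div_le_iff₀ hpos]
    linarith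
  · refine Real.sqrt_le_iff.2 ⟨by positivity, ?_⟩
    rw [div_le_iff₀ hpos]
    have h1 := mul_le_mul_of_nonneg_right hmul (sq_nonneg ε)
    have h2 := mul_le_mul_of_nonneg_left hZε (Nat.cast_nonneg (α := ℝ) N₀)
    linarith

theorem two_mul_sq_mul_exp_sampleBase_le {n : ℕ} (hn : 2 ≤ n) {M : ℝ} (hM : 0 < M) :
    2 * (n : ℝ) ^ 2 * Real.exp (-((1 + Real.log (2 * n ^ 2)) * sampleBase n M)) ≤
      (n : ℝ) ^ (-M) := by
  have hn' : (2 : ℝ) ≤ n := by exact_mod_cast hn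
  have hn0 : (0 : ℝ) < n := by linarith
  have hlog : 0 ≤ Real.log n := Real.log_nonneg (by linarith)
  have hN₀ : (1 : ℝ) ≤ sampleBase n M := by exact_mod_cast one_le_sampleBase hn hM
  have hΛ : 0 ≤ Real.log (2 * n ^ 2) := Real.log_nonneg (by nlinarith)
  have hceil : 2 * (M * Real.log n + Real.log 4) ≤ sampleBase n M := Nat.le_ceil _
  have h4 : 0 < Real.log 4 := Real.log_pos (by norm_num)
  have hMl : 0 ≤ M * Real.log n := by positivity
  rw [Real.rpow_def_of_pos hn0]
  nth_rw 1 [← Real.exp_log (show 0 < 2 * (n : ℝ) ^ 2 by positivity)]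
  rw [← Real.exp_add]
  refine Real.exp_le_exp.2 ?_
  nlinarith [mul_nonneg hΛ (sub_nonneg.2 hN₀)]

end SPS

theorem mainTheorem1 {d q n : ℕ} (hn : 2 ≤ n)
    -- the parametric correlation function, the parameter set and the distinct locations
    (X : Set (SPS.E d)) (k : SPS.E d → SPS.E d → SPS.E q → ℝ) (Θρ : Set (SPS.E q))
    (hk : ∀ t ∈ Θρ, SPS.IsCorrelationFunction X fun z z' => k z z' t)
    (x : Fin n → SPS.E d) (hxX : ∀ i, x i ∈ X) (hx : Function.Injective x)
    -- the true parameters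
    (θ : SPS.Param q) (hρ : θ.fst ∈ interior Θρ) (hv : 0 < θ.snd)
    (hC : (SPS.covMatrix k x θ).PosDef)
    (hid : SPS.IdentifiableAt k x Θρ θ.fst)
    -- the bounds `a I ⪯ P* ⪯ b I` on the true precision matrix
    (a b : ℝ) (ha : 0 < a) (hP : (SPS.covMatrix k x θ)⁻¹ ∈ SPS.spectralBox n a b)
    -- smoothness and linear independence
    (hr : ContDiffOn ℝ 2 (SPS.corrVec k x) (interior Θρ))
    (hli : LinearIndependent ℝ
      (Fin.cons (SPS.corrVec k x θ.fst)
        (fun j : Fin q =>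
          fderiv ℝ (SPS.corrVec k x) θ.fst (EuclideanSpace.single j (1 : ℝ))) :
        Fin (q + 1) → SPS.LongVec n)) :
    ∃ K > (0 : ℝ), ∃ m > (0 : ℝ), ∃ δ > (0 : ℝ), ∀ M > (0 : ℝ), ∀ ε > (0 : ℝ),
      ∃ N : ℕ, SPS.sampleBase n M ≤ N ∧
        (N : ℝ) ≤ K * SPS.sampleBase n M * max 1 (1 / ε ^ 2) ∧
        ∀ α : ℝ, α = 40 * θ.snd * √((SPS.sampleBase n M : ℝ) / N) →
        ∀ (Ω : Type*) [MeasurableSpace Ω] (μ : MeasureTheory.Measure Ω)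
          [MeasureTheory.IsProbabilityMeasure μ] (y : Fin N → Ω → SPS.E n),
          SPS.IsGRFSample k x θ μ y →
          ∃ A : Set Ω, MeasurableSet A ∧ 1 - (n : ℝ) ^ (-M) ≤ μ.real A ∧
            ∀ ω ∈ A,
              -- the two-stage estimate exists, and each such estimate is accurate
              (∃ (P : Matrix (Fin n) (Fin n) ℝ) (θhat : SPS.Param q),
                SPS.IsStageOne x a b α (SPS.sampleCov fun s => y s ω) P ∧
                SPS.IsStageTwo k x Θρ (SPS.longVec P⁻¹) θhat) ∧
              ∀ (P : Matrix (Fin n) (Fin n) ℝ) (θhat : SPS.Param q),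
                SPS.IsStageOne x a b α (SPS.sampleCov fun s => y s ω) P →
                SPS.IsStageTwo k x Θρ (SPS.longVec P⁻¹) θhat →
                ‖θhat - θ‖ ≤ ε ∧
                StrongConvexOn (Metric.ball θhat.fst δ) m
                  (SPS.stageTwoObj k x (SPS.longVec P⁻¹)) := by
  have hn' : (2 : ℝ) ≤ n := by exact_mod_cast hn
  obtain ⟨U, hU, hconc⟩ := SPS.exists_sampleCov_concentration hC.posSemidef
  obtain ⟨L₁, hL₁, hstage1⟩ := SPS.exists_stageOne_covariance_rate x ha hC hP
  obtain ⟨ρ, hρ0, L₂, hL₂, m, hm, δ, hδ, hstage2⟩ :=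
    SPS.exists_stageTwo_rate (k := k) (x := x) ⟨0, by omega⟩
      (fun t ht => (hk t ht).1 _ (hxX _)) hρ hv hid hr hli
  rw [SPS.longVec_covMatrix] at hstage1
  set Λ := 1 + Real.log (2 * (n : ℝ) ^ 2) with hΛ
  have hΛ0 : 0 < Λ := by
    have : 0 ≤ Real.log (2 * (n : ℝ) ^ 2) := Real.log_nonneg (by nlinarith)
    linarith
  set τ := √(U * Λ) with hτ
  have hτ0 : 0 < τ := Real.sqrt_pos.2 (by positivity)
  have hτ2 : τ ^ 2 = U * Λ := Real.sq_sqrt (by positivity)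
  set B := L₁ * (n * τ + 40 * θ.snd) with hB
  have hB0 : 0 < B := by positivity
  set s := min 1 (min (1 / (U * τ)) (min (ρ / B) (1 / (L₂ * B)))) with hs
  have hs0 : 0 < s := by positivity
  have hsU : s * (U * τ) ≤ 1 := by
    rw [← le_div_iff₀ (by positivity)]
    exact (min_le_right _ _).trans (min_le_left _ _)
  have hsρ : s * B ≤ ρ := by
    rw [← le_div_iff₀ (by positivity)]
    exact (min_le_right _ _).trans ((min_le_right _ _).trans (min_le_left _ _))
  have hsL : s * (L₂ * B) ≤ 1 := by
    rw [← le_div_iff₀ (by positivity)]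
    exact (min_le_right _ _).trans ((min_le_right _ _).trans (min_le_right _ _))
  refine ⟨1 / s ^ 2 + 1, by positivity, m, hm, δ, hδ, fun M hM ε hε => ?_⟩
  have hN₀ := SPS.one_le_sampleBase hn hM
  obtain ⟨N, hNN₀, hNK, hσs, hσε⟩ := SPS.exists_sampleSize hN₀ hs0 (min_le_left _ _) hε
  refine ⟨N, hNN₀, hNK, fun α hα Ω _ μ _ y hy => ?_⟩
  have hN : 0 < N := by omega
  have hN' : (0 : ℝ) < N := by exact_mod_cast hN
  have hN₀' : (0 : ℝ) < SPS.sampleBase n M := by exact_mod_cast hN₀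
  set σ := √((SPS.sampleBase n M : ℝ) / N) with hσ
  have hσ0 : 0 < σ := Real.sqrt_pos.2 (by positivity)
  have hσ2 : σ ^ 2 = SPS.sampleBase n M / N := Real.sq_sqrt (by positivity)
  have hprob := hconc N (τ * σ) hN (by positivity)
    (by
      rw [le_div_iff₀ hU]
      calc τ * σ * U ≤ τ * s * U := by gcongr
        _ ≤ 1 := by linarith)
    Ω μ y hy.1 hy.2
  have hexp : (N : ℝ) * (τ * σ) ^ 2 / U = Λ * SPS.sampleBase n M := by
    rw [mul_pow, hτ2, hσ2]
    field_simp
  rw [hexp] at hprob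
  set bad := {ω | ∃ i j, τ * σ < |SPS.sampleCov (fun s => y s ω) i j - SPS.covMatrix k x θ i j|}
  refine ⟨(toMeasurable μ bad)ᶜ, (measurableSet_toMeasurable μ bad).compl, ?_, fun ω hω => ?_⟩
  · rw [probReal_compl_eq_one_sub (measurableSet_toMeasurable μ bad)]
    have h1 : μ.real (toMeasurable μ bad) = μ.real bad := by
      simp [Measure.real, measure_toMeasurable]
    rw [h1]
    linarith [SPS.two_mul_sq_mul_exp_sampleBase_le hn hM]
  have hgood : ∀ i j, |(SPS.sampleCov (fun s => y s ω) - SPS.covMatrix k x θ) i j| ≤ τ * σ := by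
    have : ω ∉ bad := fun h => hω (subset_toMeasurable μ bad h)
    intro i j
    by_contra hcon
    exact this ⟨i, j, not_le.1 hcon⟩
  have hα0 : 0 ≤ α := by rw [hα]; positivity
  have herr : ∀ P, SPS.IsStageOne x a b α (SPS.sampleCov fun s => y s ω) P →
      ‖SPS.longVec P⁻¹ - θ.snd • SPS.corrVec k x θ.fst‖ ≤ B * σ := fun P hPS => by
    refine (hstage1 _ α hα0 P hPS).trans ?_
    have hS := SPS.norm_longVec_le_of_abs_apply_le (by positivity) hgood
    calc _ ≤ L₁ * (n * (τ * σ) + α) := by gcongr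
      _ = B * σ := by rw [hα, hB]; ring
  have hsmall : B * σ ≤ ρ := by
    calc B * σ ≤ B * s := by gcongr
      _ ≤ ρ := by linarith
  constructor
  · obtain ⟨P, hPS⟩ := SPS.exists_isStageOne x ha ⟨_, hP⟩ α (SPS.sampleCov fun s => y s ω)
    obtain ⟨θhat, hθ⟩ := (hstage2 _ ((herr P hPS).trans hsmall)).1
    exact ⟨P, θhat, hPS, hθ⟩
  · intro P θhat hPS hθ
    obtain ⟨hacc, hsc⟩ := (hstage2 _ ((herr P hPS).trans hsmall)).2 θhat hθ
    refine ⟨hacc.trans ?_, hsc⟩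
    calc _ ≤ L₂ * (B * σ) := by gcongr; exact herr P hPS
      _ ≤ L₂ * (B * (s * ε)) := by gcongr
      _ = s * (L₂ * B) * ε := by ring
      _ ≤ 1 * ε := by gcongr
      _ = ε := one_mul ε
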